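/- Noiseless non-adaptive group testing. Let $p$ items be given, let the defective set $S$ be uniform on the $\binom{p}{k}$ subsets of $\{1,\dots,p\}$ of size $k$, and let $X\in\{0,1\}^{n\times p}$, independent of $S$, have i.i.d. $\mathrm{Bernoulli}(\nu/k)$ entries, where $\nu>0$ does not depend on $p$. The $n$ outcomes are $Y_i=\mathbf 1\{X_{ij}=1\text{ for some }j\in S\}$. A decoder is a deterministic map $(X,Y)\mapsto\hat S$, which may depend on the parameters of the model, and its error probability is $P_e=\mathbb P[\hat S\ne S]$. Write $\log$ for the natural logarithm and $H_2(x)=-x\log x-(1-x)\log(1-x)$. Fix $\theta\in(0,1)$ and put $$c_\theta(\nu)=\max\Big\{\frac{\theta}{e^{-\nu}\nu(1-\theta)},\ \frac{1}{H_2(e^{-\nu})}\Big\},\qquad c^*_\theta=\inf_{\nu>0}c_\theta(\nu).$$ Let $k=k_p$ and $n=n_p$ be sequences of non-negative integers with $k=\Theta(p^\theta)$ as $p\to\infty$, and let $\eta>0$ be a constant. (i) The infimum $c^*_\theta$ is attained, and for every $\nu>0$ with $c_\theta(\nu)=c^*_\theta$: if $$n\ \ge\ c^*_\theta\,\Big(k\log\frac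 pk\Big)(1+\eta)$$ for all sufficiently large $p$, then there are decoders for which $P_e\to0$ as $p\to\infty$. (ii) Conversely, for every constant $\nu>0$: if $$n\ \le\ \frac{k\log\frac pk}{\log2}(1-\eta)$$ for all sufficiently large $p$, then $P_e\to1$ as $p\to\infty$ for every sequence of decoders. (iii) If $\theta\le\frac13$, then $c^*_\theta=\frac1{\log2}$, attained at $\nu=\log2$. Hence $k\log_2\frac pk$ is the exact threshold: with $\nu=\log2$, there are decoders for which $P_e\to0$ if $n\ge \big(k\log_2\frac pk\big)(1+\eta)$ for all sufficiently large $p$, whereas $P_e\to1$ for every constant $\nu>0$ and every sequence of decoders if $n\le\big(k\log_2\frac pk\big)(1-\eta)$ for all sufficiently large $p$. -/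

import Mathlib

open Filter Topology MeasureTheory ProbabilityTheory Asymptotics

noncomputable section

namespace GroupTesting

/-- A (non-adaptive) test design: `X i j = true` iff item `j` takes part in test `i`, for `n` tests
and `p` items. -/
abbrev Design (n p : ℕ) : Type := Fin n → Fin p → Bool

/-- The noiseless outcomes `Y i = 1{⋃_{j ∈ S} {X i j = 1}}` for the defective set `S`. -/
def outcome {n p : ℕ} (S : Finset (Fin p)) (X : Design n p) : Fin n → Bool :=
  fun i => decide (∃ j ∈ S, X i j = true)

/-- A deterministic decoder: an estimate of the defective set from the design and the outcomes.
It may depend on all the parameters of the model. -/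
abbrev Decoder (n p : ℕ) : Type := Design n p → (Fin n → Bool) → Finset (Fin p)

/-- The probability `ν / k` that an item takes part in a test. It is truncated to `[0, 1]`, which has
no effect once `0 ≤ ν ≤ k`. -/
def inclusionProb (ν : ℝ) (k : ℕ) : unitInterval :=
  Set.projIcc (0 : ℝ) 1 zero_le_one (ν / k)

/-- The law of a design with i.i.d. Bernoulli(`ν / k`) entries. -/
def designLaw (n p k : ℕ) (ν : ℝ) : Measure (Design n p) :=
  Measure.pi fun _ => Measure.pi fun _ => bernoulliMeasure true false (inclusionProb ν k)

/-- The law of the defective set: uniform on the subsets of size `k` of the `p` items. -/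
def defectiveLaw (p k : ℕ) : Measure (Finset (Fin p)) :=
  uniformOn {S : Finset (Fin p) | S.card = k}

/-- The joint law of the defective set and of the design, which are independent. -/
def modelLaw (n p k : ℕ) (ν : ℝ) : Measure (Finset (Fin p) × Design n p) :=
  (defectiveLaw p k).prod (designLaw n p k ν)

/-- The error probability `P_e = ℙ[Ŝ ≠ S]` of a decoder. -/
def errorProb (n p k : ℕ) (ν : ℝ) (dec : Decoder n p) : ℝ :=
  (modelLaw n p k ν).real {ω | dec ω.2 (outcome ω.1 ω.2) ≠ ω.1}

/-- The coefficient `max {θ / (e^{-ν} ν (1 - θ)), 1 / H₂(e^{-ν})}`, with `H₂` in nats. -/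
def coeff (θ ν : ℝ) : ℝ :=
  max (θ / (Real.exp (-ν) * ν * (1 - θ))) (1 / Real.binEntropy (Real.exp (-ν)))

/-- The infimum of the coefficient over the design parameters `ν > 0`. -/
def optCoeff (θ : ℝ) : ℝ := ⨅ ν : Set.Ioi (0 : ℝ), coeff θ ν

/-- `ν` is an optimized design parameter: it is positive and attains the infimum. -/
def IsOptimalParam (θ ν : ℝ) : Prop := 0 < ν ∧ coeff θ ν = optCoeff θ

/-- The sparsity regime `k = Θ(p^θ)` as `p → ∞`. -/
def SparsityRegime (θ : ℝ) (k : ℕ → ℕ) : Prop :=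
  (fun p => (k p : ℝ)) =Θ[atTop] fun p => (p : ℝ) ^ θ

end GroupTesting

end

/-!
**Achievability.** The decoder returns any `k`-set that explains the outcomes. Let `S` be the defective
set and let another `k`-set differ from it by replacing `D ⊆ S`, `ℓ = D.card`, by a set `T` of `ℓ`
non-defective items. Given the columns of `S`, each such `T` explains the outcomes with the same
probability `Q`, a product over the tests, where a factor depends on which of `S \ D` and `D` the test
meets. With `M` replacements, the conditional probability that one of them explains the outcomes is
at most `min 1 (M Q) ≤ (M Q) ^ s` for every `s ∈ [0, 1]`, and the expectation of `Q ^ s` factorizes over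
the independent tests. `designLaw_exists_consistent_le` is this bound, up to a factor `2` that allows
it to be proved without conditioning. Tilting by `s` takes the place of concentration inequalities.

The union bound `errorProb_consistentDecoder_le` is then a sum over `ℓ`.
* For `ℓ ≤ δ k` (`few_misidentified_le`), the obstacle is a defective item that is never the only
  defective item of a test: the mean number of tests that isolate a given defective item has to exceed
  `log k`, which is what the first term of the coefficient ensures.
* For `ℓ > δ k` (`many_misidentified_le`), a small `s` makes the decay rate `s` times the mutual
  information, `(1 - q) ^ (k - ℓ) * H₂((1 - q) ^ ℓ)` per test. By monotonicity of
  `u ↦ H₂(u) / (u * (-log u))` this is at least `ℓ / k` times its value at `ℓ = k`, which tends to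
  `H₂(e^{-ν})` (`div_mul_binEntropy_pow_le`); the second term of the coefficient says that this suffices.

Both kinds of terms are at most `2 * (p ^ (-c)) ^ ℓ` for a constant `c > 0`, so that the sum vanishes
(`tendsto_errorProb_consistentDecoder`).

**Converse.** A given design has at most `2 ^ n` outcomes, so at most `2 ^ n` of the
`p.choose k ≥ (p / k) ^ k` sets are decoded correctly (`one_sub_errorProb_le`).

**Optimization.** The coefficient is continuous and blows up at `0` and at infinity, so it attains its
infimum (`exists_isOptimalParam`). Its second term is at least `1 / log 2`, with equality at `ν = log 2`,
where for `θ ≤ 1 / 3` the first term is not larger (`isOptimalParam_log_two`).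
-/

namespace GroupTesting

noncomputable section

/-! ### Rows of the design -/

/-- The law of one row of the design: the i.i.d. Bernoulli(`q`) indicators of the items that take part
in a given test. -/
def rowLaw (p : ℕ) (q : unitInterval) : Measure (Fin p → Bool) :=
  Measure.pi fun _ => bernoulliMeasure true false q

instance rowLaw_isProbabilityMeasure (p : ℕ) (q : unitInterval) :
    IsProbabilityMeasure (rowLaw p q) := by
  unfold rowLaw; infer_instance

theorem designLaw_eq_pi_rowLaw (n p k : ℕ) (ν : ℝ) :
    designLaw n p k ν = Measure.pi fun _ => rowLaw p (inclusionProb ν k) := rfl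

instance designLaw_isProbabilityMeasure (n p k : ℕ) (ν : ℝ) :
    IsProbabilityMeasure (designLaw n p k ν) := by
  rw [designLaw_eq_pi_rowLaw]; infer_instance

/-- The real indicator that a test with row `x` contains no item of `A`. -/
def avoids {p : ℕ} (A : Finset (Fin p)) (x : Fin p → Bool) : ℝ :=
  ∏ j ∈ A, if x j = true then 0 else 1

theorem avoids_eq_ite {p : ℕ} (A : Finset (Fin p)) (x : Fin p → Bool) :
    avoids A x = if ∃ j ∈ A, x j = true then 0 else 1 := by
  unfold avoids
  split_ifs with h
  · obtain ⟨j, hj, hx⟩ := h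
    exact Finset.prod_eq_zero hj (by simp [hx])
  · push Not at h
    exact Finset.prod_eq_one fun j hj => by simp [h j hj]

theorem avoids_union {p : ℕ} {A B : Finset (Fin p)} (h : Disjoint A B) (x : Fin p → Bool) :
    avoids (A ∪ B) x = avoids A x * avoids B x :=
  Finset.prod_union h

theorem integral_avoids {p : ℕ} (q : unitInterval) (A : Finset (Fin p)) :
    ∫ x, avoids A x ∂rowLaw p q = (1 - (q : ℝ)) ^ A.card := by
  have h : ∀ x : Fin p → Bool,
      avoids A x = ∏ j, (fun b : Bool => if j ∈ A then (if b = true then (0 : ℝ) else 1) else 1)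
        (x j) := by
    intro x
    simp only [avoids]
    rw [Finset.prod_ite_mem, Finset.univ_inter]
  simp_rw [h]
  rw [rowLaw, integral_fintype_prod_eq_prod
    (f := fun j (b : Bool) => if j ∈ A then (if b = true then (0 : ℝ) else 1) else 1)]
  simp_rw [integral_bernoulliMeasure]
  rw [← Finset.prod_const, ← Finset.univ_inter A, ← Finset.prod_ite_mem]
  refine Finset.prod_congr rfl fun j _ => ?_
  by_cases hj : j ∈ A <;> simp [hj]

/-- A weight of a row, given disjoint sets `E` and `D`: it is `1` if the test meets `E`, `a` if it
avoids `E ∪ D`, and `b` if it meets `D` but not `E`. -/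
def rowWeight {p : ℕ} (E D : Finset (Fin p)) (a b : ℝ) (x : Fin p → Bool) : ℝ :=
  (1 - avoids E x) + avoids E x * avoids D x * a + avoids E x * (1 - avoids D x) * b

/-- The row weight restricted to the tests in which `E ∪ D` and `E ∪ T` have the same outcome. -/
def matchWeight {p : ℕ} (E D T : Finset (Fin p)) (a b : ℝ) (x : Fin p → Bool) : ℝ :=
  (1 - avoids E x) + avoids E x * avoids D x * avoids T x * a
    + avoids E x * (1 - avoids D x) * (1 - avoids T x) * b

theorem integral_rowWeight {p : ℕ} (q : unitInterval) {E D : Finset (Fin p)} (h : Disjoint E D)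
    (a b : ℝ) :
    ∫ x, rowWeight E D a b x ∂rowLaw p q =
      1 - (1 - (q : ℝ)) ^ E.card + (1 - (q : ℝ)) ^ E.card *
        ((1 - (q : ℝ)) ^ D.card * a + (1 - (1 - (q : ℝ)) ^ D.card) * b) := by
  have h1 : ∀ x, rowWeight E D a b x =
      1 + (b - 1) * avoids E x + (a - b) * avoids (E ∪ D) x := by
    intro x; rw [avoids_union h]; unfold rowWeight; ring
  simp_rw [h1]
  rw [integral_add .of_finite .of_finite, integral_add .of_finite .of_finite,
    integral_const_mul, integral_const_mul, integral_avoids, integral_avoids,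
    Finset.card_union_of_disjoint h, pow_add]
  simp
  ring

theorem integral_matchWeight {p : ℕ} (q : unitInterval) {E D T : Finset (Fin p)}
    (hED : Disjoint E D) (hET : Disjoint E T) (hDT : Disjoint D T) (a b : ℝ) :
    ∫ x, matchWeight E D T a b x ∂rowLaw p q =
      1 - (1 - (q : ℝ)) ^ E.card + (1 - (q : ℝ)) ^ E.card *
        ((1 - (q : ℝ)) ^ D.card * ((1 - (q : ℝ)) ^ T.card * a) +
          (1 - (1 - (q : ℝ)) ^ D.card) * ((1 - (1 - (q : ℝ)) ^ T.card) * b)) := by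
  have hEDT : Disjoint (E ∪ D) T := Finset.disjoint_union_left.2 ⟨hET, hDT⟩
  have h1 : ∀ x, matchWeight E D T a b x =
      1 + (b - 1) * avoids E x + (-b) * avoids (E ∪ D) x + (-b) * avoids (E ∪ T) x
        + (a + b) * avoids (E ∪ D ∪ T) x := by
    intro x
    rw [avoids_union hEDT, avoids_union hED, avoids_union hET]; unfold matchWeight; ring
  simp_rw [h1]
  rw [integral_add .of_finite .of_finite, integral_add .of_finite .of_finite,
    integral_add .of_finite .of_finite, integral_add .of_finite .of_finite,
    integral_const_mul, integral_const_mul, integral_const_mul, integral_const_mul,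
    integral_avoids, integral_avoids, integral_avoids, integral_avoids,
    Finset.card_union_of_disjoint hEDT, Finset.card_union_of_disjoint hED,
    Finset.card_union_of_disjoint hET, pow_add, pow_add, pow_add]
  simp
  ring

theorem rowWeight_pos {p : ℕ} (E D : Finset (Fin p)) {a b : ℝ} (ha : 0 < a) (hb : 0 < b)
    (x : Fin p → Bool) : 0 < rowWeight E D a b x := by
  simp only [rowWeight, avoids_eq_ite]
  split_ifs <;> simp [ha, hb]

theorem rowWeight_rpow {p : ℕ} (E D : Finset (Fin p)) (a b s : ℝ) (x : Fin p → Bool) :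
    rowWeight E D a b x ^ s = rowWeight E D (a ^ s) (b ^ s) x := by
  simp only [rowWeight, avoids_eq_ite]
  split_ifs <;> simp

theorem matchWeight_nonneg {p : ℕ} (E D T : Finset (Fin p)) {a b : ℝ} (ha : 0 ≤ a) (hb : 0 ≤ b)
    (x : Fin p → Bool) : 0 ≤ matchWeight E D T a b x := by
  simp only [matchWeight, avoids_eq_ite]
  split_ifs <;> simp [ha, hb]

theorem rowWeight_eq_matchWeight {n p : ℕ} {E D T : Finset (Fin p)} {X : Design n p}
    (h : outcome (E ∪ T) X = outcome (E ∪ D) X) (a b : ℝ) (i : Fin n) :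
    rowWeight E D a b (X i) = matchWeight E D T a b (X i) := by
  have hi := congrFun h i
  simp only [outcome, decide_eq_decide, Finset.mem_union, or_and_right, exists_or] at hi
  simp only [rowWeight, matchWeight, avoids_eq_ite]
  by_cases hE : ∃ j ∈ E, X i j = true
  · simp [hE]
  · by_cases hD : ∃ j ∈ D, X i j = true <;> by_cases hT : ∃ j ∈ T, X i j = true <;>
      simp only [hE, hD, hT, false_or, iff_true, iff_false, not_true] at hi ⊢ <;> simp

/-- The exponential rate, per test, at which the `s`-tilted probability that a set sharing `m` items
with the defective set, and differing from it in `ℓ` items, is consistent with the outcomes decays;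
`q` is the inclusion probability. -/
def gain (q : ℝ) (m ℓ : ℕ) (s : ℝ) : ℝ :=
  (1 - q) ^ m * ((1 - q) ^ ℓ * (1 - ((1 - q) ^ ℓ) ^ s) +
    (1 - (1 - q) ^ ℓ) * (1 - (1 - (1 - q) ^ ℓ) ^ s))

/-! ### Achievability: the tilted union bound -/

/-- The probability that replacing the items `D` of the defective set `E ∪ D` by some other items of
equal number explains the outcomes. With `M` the number of replacements and `Q` the conditional
probability, given the columns of `E ∪ D`, that a given one of them explains the outcomes, the
indicator of the event is at most `(M Q) ^ s + ∑ T, 𝟙_T (M Q) ^ (s - 1)`, and every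
term on the right is a product over the independent rows. -/
theorem designLaw_exists_consistent_le {n p k : ℕ} {ν : ℝ} {E D : Finset (Fin p)}
    (hED : Disjoint E D) (hD : D.Nonempty)
    (hq0 : 0 < (inclusionProb ν k : ℝ)) (hq1 : (inclusionProb ν k : ℝ) < 1) {s : ℝ} (hs0 : 0 ≤ s)
    (hs1 : s ≤ 1) :
    (designLaw n p k ν).real
      {X | ∃ T ∈ (E ∪ D)ᶜ.powersetCard D.card, outcome (E ∪ T) X = outcome (E ∪ D) X} ≤
      2 * ((p - (E ∪ D).card).choose D.card : ℝ) ^ s *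
        (1 - gain (inclusionProb ν k) E.card D.card s) ^ n := by
  classical
  set q : ℝ := (inclusionProb ν k : ℝ) with hq
  set u : ℝ := (1 - q) ^ D.card with hu
  have hu0 : 0 < u := pow_pos (by linarith) _
  have hu1 : u < 1 := pow_lt_one₀ (by linarith) (by linarith) hD.card_pos.ne'
  have hw0 : 0 < 1 - u := by linarith
  set 𝒯 := (E ∪ D)ᶜ.powersetCard D.card with h𝒯
  have hcard : 𝒯.card = (p - (E ∪ D).card).choose D.card := by
    rw [h𝒯, Finset.card_powersetCard, Finset.card_compl, Fintype.card_fin]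
  rw [← hcard]
  set R : ℝ := 1 - gain q E.card D.card s with hR
  have hR_row : ∫ x, rowWeight E D (u ^ s) ((1 - u) ^ s) x ∂rowLaw p (inclusionProb ν k) = R := by
    rw [integral_rowWeight _ hED, hR, gain, ← hq, ← hu]; ring
  have hR_match : ∀ T ∈ 𝒯, ∫ x, matchWeight E D T (u ^ (s - 1)) ((1 - u) ^ (s - 1)) x
      ∂rowLaw p (inclusionProb ν k) = R := by
    intro T hT
    rw [h𝒯, Finset.mem_powersetCard] at hT
    have hd : Disjoint (E ∪ D) T := Finset.subset_compl_iff_disjoint_left.1 hT.1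
    rw [Finset.disjoint_union_left] at hd
    rw [integral_matchWeight _ hED hd.1 hd.2, hT.2, ← hq, ← hu, Real.rpow_sub_one hu0.ne',
      Real.rpow_sub_one hw0.ne', mul_div_cancel₀ _ hu0.ne', mul_div_cancel₀ _ hw0.ne', hR, gain,
      ← hu]
    ring
  have hRn : 0 ≤ R := by
    rw [← hR_row]
    exact integral_nonneg fun x =>
      (rowWeight_pos E D (Real.rpow_pos_of_pos hu0 s) (Real.rpow_pos_of_pos hw0 s) x).le
  rcases Finset.eq_empty_or_nonempty 𝒯 with h0 | hne
  · simp only [h0, Finset.notMem_empty, false_and, exists_false, Set.ofPred_false,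
      measureReal_empty]
    positivity
  have hM : (0 : ℝ) < 𝒯.card := by exact_mod_cast hne.card_pos
  set M : ℝ := (𝒯.card : ℝ) with hMdef
  set Q : Design n p → ℝ := fun X => ∏ i, rowWeight E D u (1 - u) (X i) with hQ
  have hQ0 : ∀ X, 0 < Q X := fun X => Finset.prod_pos fun i _ => rowWeight_pos E D hu0 hw0 _
  have hQs : ∀ X (t : ℝ), Q X ^ t = ∏ i, rowWeight E D (u ^ t) ((1 - u) ^ t) (X i) := by
    intro X t
    rw [hQ, ← Real.finsetProd_rpow _ _ fun i _ => (rowWeight_pos E D hu0 hw0 _).le]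
    simp_rw [rowWeight_rpow]
  -- The exponent is `s - 1`: integrating the indicator of a match contributes one more factor of `Q`,
  -- so that `P T` and `Q ^ s` have the same mean.
  set P : Finset (Fin p) → Design n p → ℝ := fun T X =>
    ∏ i, matchWeight E D T (u ^ (s - 1)) ((1 - u) ^ (s - 1)) (X i) with hP
  have hP0 : ∀ T X, 0 ≤ P T X := fun T X => Finset.prod_nonneg fun i _ =>
    matchWeight_nonneg E D T (Real.rpow_nonneg hu0.le _) (Real.rpow_nonneg hw0.le _) _
  set A : Set (Design n p) := {X | ∃ T ∈ 𝒯, outcome (E ∪ T) X = outcome (E ∪ D) X} with hA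
  have hpt : ∀ X, A.indicator (fun _ => (1 : ℝ)) X ≤
      M ^ s * Q X ^ s + M ^ (s - 1) * ∑ T ∈ 𝒯, P T X := by
    intro X
    have h1 : 0 ≤ M ^ s * Q X ^ s :=
      mul_nonneg (Real.rpow_nonneg hM.le _) (Real.rpow_nonneg (hQ0 X).le _)
    have h2 : 0 ≤ M ^ (s - 1) * ∑ T ∈ 𝒯, P T X :=
      mul_nonneg (Real.rpow_nonneg hM.le _) (Finset.sum_nonneg fun T _ => hP0 T X)
    by_cases hX : X ∈ A
    · rw [Set.indicator_of_mem hX]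
      obtain ⟨T, hT, hTX⟩ := hX
      -- `1 ≤ (M Q) ^ s` if `1 ≤ M Q`, and `1 ≤ (M Q) ^ (s - 1)` otherwise.
      rcases le_or_gt 1 (M * Q X) with hMQ | hMQ
      · have : 1 ≤ M ^ s * Q X ^ s := by
          rw [← Real.mul_rpow hM.le (hQ0 X).le]
          exact Real.one_le_rpow hMQ hs0
        linarith
      · have h3 : 1 ≤ M ^ (s - 1) * Q X ^ (s - 1) := by
          rw [← Real.mul_rpow hM.le (hQ0 X).le]
          exact Real.one_le_rpow_of_pos_of_le_one_of_nonpos (mul_pos hM (hQ0 X)) hMQ.le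
            (by linarith)
        have h4 : Q X ^ (s - 1) ≤ ∑ T ∈ 𝒯, P T X := by
          have : Q X ^ (s - 1) = P T X := by
            rw [hQs, hP]
            exact Finset.prod_congr rfl fun i _ => rowWeight_eq_matchWeight hTX _ _ i
          rw [this]
          exact Finset.single_le_sum (f := fun T => P T X) (fun T _ => hP0 T X) hT
        have h5 := mul_le_mul_of_nonneg_left h4 (Real.rpow_nonneg hM.le (s - 1))
        linarith
    · rw [Set.indicator_of_notMem hX]
      linarith
  calc (designLaw n p k ν).real A
      = ∫ X, A.indicator (fun _ => (1 : ℝ)) X ∂designLaw n p k ν := by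
        rw [integral_indicator (Set.toFinite A).measurableSet]; simp
    _ ≤ ∫ X, (M ^ s * Q X ^ s + M ^ (s - 1) * ∑ T ∈ 𝒯, P T X) ∂designLaw n p k ν :=
        integral_mono .of_finite .of_finite hpt
    _ = M ^ s * R ^ n + M ^ (s - 1) * ∑ T ∈ 𝒯, R ^ n := by
        rw [integral_add .of_finite .of_finite, integral_const_mul, integral_const_mul,
          integral_finsetSum _ fun _ _ => .of_finite, designLaw_eq_pi_rowLaw]
        simp_rw [hQs, hP]
        rw [integral_fintype_prod_eq_pow, hR_row, Fintype.card_fin]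
        congr 2
        refine Finset.sum_congr rfl fun T hT => ?_
        rw [integral_fintype_prod_eq_pow, hR_match T hT, Fintype.card_fin]
    _ = 2 * M ^ s * R ^ n := by
        rw [Finset.sum_const, nsmul_eq_mul, ← hMdef, Real.rpow_sub_one hM.ne']
        field_simp
        ring

/-- The decoder that returns some set of size `k` explaining the outcomes (and `∅` if there is
none). -/
def consistentDecoder (n p k : ℕ) : Decoder n p :=
  open Classical in
  fun X y => if h : ∃ S : Finset (Fin p), S.card = k ∧ outcome S X = y then h.choose else ∅

theorem consistentDecoder_spec {n p k : ℕ} {S : Finset (Fin p)} (hS : S.card = k)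
    (X : Design n p) :
    (consistentDecoder n p k X (outcome S X)).card = k ∧
      outcome (consistentDecoder n p k X (outcome S X)) X = outcome S X := by
  have h : ∃ S' : Finset (Fin p), S'.card = k ∧ outcome S' X = outcome S X := ⟨S, hS, rfl⟩
  rw [consistentDecoder, dif_pos h]
  exact h.choose_spec

theorem isProbabilityMeasure_defectiveLaw {p k : ℕ} (hk : k ≤ p) :
    IsProbabilityMeasure (defectiveLaw p k) := by
  refine isProbabilityMeasure_uniformOn (Set.toFinite _) ?_
  obtain ⟨S, -, hS⟩ := Finset.exists_subset_card_eq (s := (Finset.univ : Finset (Fin p)))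
    (n := k) (by simpa using hk)
  exact ⟨S, hS⟩

theorem errorProb_le_of_forall {n p k : ℕ} {ν B : ℝ} {dec : Decoder n p} (hk : k ≤ p)
    (h : ∀ S : Finset (Fin p), S.card = k →
      (designLaw n p k ν).real {X | dec X (outcome S X) ≠ S} ≤ B) :
    errorProb n p k ν dec ≤ B := by
  have := isProbabilityMeasure_defectiveLaw hk
  have hB : 0 ≤ B := by
    obtain ⟨S, -, hS⟩ := Finset.exists_subset_card_eq (s := (Finset.univ : Finset (Fin p)))
      (n := k) (by simpa using hk)
    exact measureReal_nonneg.trans (h S hS)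
  rw [errorProb, modelLaw, measureReal_def, Measure.prod_apply (Set.toFinite _).measurableSet]
  refine ENNReal.toReal_le_of_le_ofReal hB ?_
  calc ∫⁻ S, designLaw n p k ν (Prod.mk S ⁻¹' {ω | dec ω.2 (outcome ω.1 ω.2) ≠ ω.1})
        ∂defectiveLaw p k
      ≤ ∫⁻ _, ENNReal.ofReal B ∂defectiveLaw p k := by
        refine lintegral_mono_ae ?_
        have hae : ∀ᵐ S ∂defectiveLaw p k, S ∈ {S : Finset (Fin p) | S.card = k} :=
          ae_cond_mem (Set.toFinite _).measurableSet
        filter_upwards [hae] with S hS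
        rw [← ofReal_measureReal]
        exact ENNReal.ofReal_le_ofReal (h S hS)
    _ = ENNReal.ofReal B := by simp

/-- Union bound for the decoder that returns a consistent set; the tilting parameter `s ℓ` may depend
on the number `ℓ` of misidentified items. -/
theorem errorProb_consistentDecoder_le {n p k : ℕ} {ν : ℝ} (hk : k ≤ p)
    (hq0 : 0 < (inclusionProb ν k : ℝ)) (hq1 : (inclusionProb ν k : ℝ) < 1) {s : ℕ → ℝ}
    (hs0 : ∀ ℓ, 0 ≤ s ℓ) (hs1 : ∀ ℓ, s ℓ ≤ 1) :
    errorProb n p k ν (consistentDecoder n p k) ≤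
      ∑ ℓ ∈ Finset.Icc 1 k, (k.choose ℓ : ℝ) * (2 * ((p - k).choose ℓ : ℝ) ^ s ℓ *
        (1 - gain (inclusionProb ν k) (k - ℓ) ℓ (s ℓ)) ^ n) := by
  classical
  refine errorProb_le_of_forall hk fun S hS => ?_
  set A : Finset (Fin p) → Set (Design n p) := fun D =>
    {X | ∃ T ∈ Sᶜ.powersetCard D.card, outcome (S \ D ∪ T) X = outcome S X} with hA
  have hsub : {X : Design n p | consistentDecoder n p k X (outcome S X) ≠ S} ⊆
      ⋃ ℓ ∈ Finset.Icc 1 k, ⋃ D ∈ S.powersetCard ℓ, A D := by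
    intro X hX
    -- An estimate `S'` is reached from `S` by replacing `S \ S'` by `S' \ S`.
    obtain ⟨hc, ho⟩ := consistentDecoder_spec hS X
    set S' := consistentDecoder n p k X (outcome S X)
    have hne : S' ≠ S := hX
    have hDS : S \ S' ⊆ S := Finset.sdiff_subset
    have hcard : (S' \ S).card = (S \ S').card :=
      Finset.card_sdiff_comm (hc.trans hS.symm)
    simp only [Set.mem_iUnion]
    refine ⟨(S \ S').card, ?_, S \ S', Finset.mem_powersetCard.2 ⟨hDS, rfl⟩, S' \ S, ?_, ?_⟩
    · rw [Finset.mem_Icc]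
      refine ⟨Finset.card_pos.2 ?_, hS ▸ Finset.card_le_card hDS⟩
      rw [Finset.sdiff_nonempty]
      exact fun hss => hne (Finset.eq_of_subset_of_card_le hss (by omega)).symm
    · rw [Finset.mem_powersetCard]
      exact ⟨fun j hj => by simp_all, hcard⟩
    · rw [← ho]
      congr 1
      ext j; simp; tauto
  calc (designLaw n p k ν).real {X | consistentDecoder n p k X (outcome S X) ≠ S}
      ≤ ∑ ℓ ∈ Finset.Icc 1 k, ∑ D ∈ S.powersetCard ℓ, (designLaw n p k ν).real (A D) :=
        (measureReal_mono hsub (measure_ne_top _ _)).trans <|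
          (measureReal_biUnion_finset_le _ _).trans <|
          Finset.sum_le_sum fun ℓ _ => measureReal_biUnion_finset_le _ _
    _ ≤ _ := by
        refine Finset.sum_le_sum fun ℓ hℓ => ?_
        rw [← hS, ← Finset.card_powersetCard, ← nsmul_eq_mul, hS]
        refine Finset.sum_le_card_nsmul _ _ _ fun D hD => ?_
        obtain ⟨hDS, hDc⟩ := Finset.mem_powersetCard.1 hD
        have hDn : D.Nonempty := by
          rw [← Finset.card_pos, hDc]; exact (Finset.mem_Icc.1 hℓ).1
        have h := designLaw_exists_consistent_le (n := n) (k := k) (ν := ν)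
          (Finset.sdiff_disjoint : Disjoint (S \ D) D) hDn hq0 hq1 (hs0 ℓ) (hs1 ℓ)
        rw [Finset.card_sdiff_of_subset hDS, Finset.sdiff_union_of_subset hDS, hS, hDc] at h
        simpa only [hA, hDc] using h

/-! ### Converse: counting -/

/-- For every decoder, at most `2 ^ n` of the defective sets are recovered from a given design. -/
theorem one_sub_errorProb_le {n p k : ℕ} {ν : ℝ} (hk : k ≤ p) (dec : Decoder n p) :
    1 - errorProb n p k ν dec ≤ 2 ^ n / (p.choose k : ℝ) := by
  classical
  have := isProbabilityMeasure_defectiveLaw hk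
  have hset : {ω : Finset (Fin p) × Design n p | dec ω.2 (outcome ω.1 ω.2) ≠ ω.1} =
      {ω | dec ω.2 (outcome ω.1 ω.2) = ω.1}ᶜ := rfl
  have hprob : IsProbabilityMeasure (modelLaw n p k ν) := by unfold modelLaw; infer_instance
  rw [errorProb, hset, probReal_compl_eq_one_sub (Set.toFinite _).measurableSet, sub_sub_cancel,
    modelLaw, measureReal_def, Measure.prod_apply_symm (Set.toFinite _).measurableSet]
  have hch : 0 < p.choose k := Nat.choose_pos hk
  refine ENNReal.toReal_le_of_le_ofReal (by positivity) ?_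
  have hX : ∀ X : Design n p, defectiveLaw p k
      ((fun S => (S, X)) ⁻¹' {ω | dec ω.2 (outcome ω.1 ω.2) = ω.1}) ≤
      ENNReal.ofReal (2 ^ n / (p.choose k : ℝ)) := by
    intro X
    set G : Finset (Finset (Fin p)) := Finset.univ.filter fun S => dec X (outcome S X) = S with hG
    have h1 : ((fun S => (S, X)) ⁻¹' {ω | dec ω.2 (outcome ω.1 ω.2) = ω.1}) =
        (G : Set (Finset (Fin p))) := by ext S; simp [hG]
    have h2 : {S : Finset (Fin p) | S.card = k} =
        ((Finset.univ.powersetCard k : Finset (Finset (Fin p))) : Set (Finset (Fin p))) := by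
      ext S; simp
    have hGc : G.card ≤ 2 ^ n := by
      have : G.card ≤ (Finset.univ : Finset (Fin n → Bool)).card := by
        refine Finset.card_le_card_of_injOn (fun S => outcome S X) (fun _ _ => by simp) ?_
        intro S hS S' hS' hSS'
        rw [hG, Finset.mem_coe, Finset.mem_filter] at hS hS'
        have hSS : outcome S X = outcome S' X := hSS'
        rw [← hS.2, hSS, hS'.2]
      simpa using this
    rw [h1, defectiveLaw, h2, uniformOn_apply_finset, Finset.card_powersetCard, Finset.card_univ,
      Fintype.card_fin, ENNReal.ofReal_div_of_pos (by exact_mod_cast hch)]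
    have h3 : (Finset.univ.powersetCard k ∩ G).card ≤ 2 ^ n :=
      (Finset.card_le_card Finset.inter_subset_right).trans hGc
    refine ENNReal.div_le_div ?_ (by simp)
    rw [ENNReal.ofReal_pow (by norm_num)]
    simp only [ENNReal.ofReal_ofNat]
    exact_mod_cast h3
  calc _ ≤ ∫⁻ _, ENNReal.ofReal (2 ^ n / (p.choose k : ℝ)) ∂designLaw n p k ν := lintegral_mono hX
    _ = _ := by simp


/-! ### Entropy inequalities and bounds on the gain -/

/-- Monotonicity of `x ↦ -log (1 - x) / x` on `(0, 1)`. -/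
theorem mul_log_one_sub_le {x y : ℝ} (hx : 0 ≤ x) (hxy : x ≤ y) (hy0 : 0 < y) (hy : y < 1) :
    x * Real.log (1 - y) ≤ y * Real.log (1 - x) := by
  have h := rpow_one_add_le_one_add_mul_self (s := -y) (p := x / y) (by linarith)
    (by positivity) (by rwa [div_le_one hy0])
  have h1 : 1 + x / y * -y = 1 - x := by field_simp; ring
  rw [h1, ← sub_eq_add_neg] at h
  have h2 := Real.log_le_log (Real.rpow_pos_of_pos (by linarith) _) h
  rw [Real.log_rpow (by linarith), div_mul_eq_mul_div, div_le_iff₀ hy0] at h2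
  linarith

/-- Monotonicity of `u ↦ H₂(u) / (u * (-log u))` on `(0, 1)`: this function is `1 + A(u) / A(1 - u)`,
where `A(u) = -log (1 - u) / u` is increasing. -/
theorem binEntropy_mul_negMulLog_le {u v : ℝ} (hu : 0 < u) (huv : u ≤ v) (hv : v < 1) :
    Real.binEntropy u * (v * -Real.log v) ≤ Real.binEntropy v * (u * -Real.log u) := by
  have h1 := mul_log_one_sub_le hu.le huv (hu.trans_le huv) hv
  have h2 := mul_log_one_sub_le (x := 1 - v) (y := 1 - u) (by linarith) (by linarith)
    (by linarith) (by linarith)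
  rw [sub_sub_cancel, sub_sub_cancel] at h2
  have hb : 0 ≤ -Real.log (1 - u) := by
    have := Real.log_nonpos (x := 1 - u) (by linarith) (by linarith)
    linarith
  have ha : 0 ≤ -Real.log u := by
    have := Real.log_nonpos hu.le (by linarith)
    linarith
  have h3 : (v * -Real.log (1 - u)) * ((1 - u) * -Real.log v) ≤
      (u * -Real.log (1 - v)) * ((1 - v) * -Real.log u) := by
    apply mul_le_mul
    · linarith
    · linarith
    · have := Real.log_nonpos (hu.trans_le huv).le hv.le
      exact mul_nonneg (by linarith) (by linarith)
    · have := Real.log_nonpos (x := 1 - v) (by linarith) (by linarith)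
      exact mul_nonneg hu.le (by linarith)
  simp only [Real.binEntropy, Real.log_inv]
  linarith

/-- Recovering `ℓ` of the `k` items, once the others are known, is at least as informative per item as
recovering all of them; `r` is the probability that an item is left out of a test. -/
theorem div_mul_binEntropy_pow_le {r : ℝ} (hr0 : 0 < r) (hr1 : r < 1) {k ℓ : ℕ} (hℓ : 0 < ℓ)
    (hℓk : ℓ ≤ k) :
    (ℓ / k : ℝ) * Real.binEntropy (r ^ k) ≤ r ^ (k - ℓ) * Real.binEntropy (r ^ ℓ) := by
  have h := binEntropy_mul_negMulLog_le (pow_pos hr0 k) (pow_le_pow_of_le_one hr0.le hr1.le hℓk)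
    (pow_lt_one₀ hr0.le hr1 hℓ.ne')
  rw [Real.log_pow, Real.log_pow] at h
  have hk : (0 : ℝ) < k := by exact_mod_cast hℓ.trans_le hℓk
  have hlog : 0 < -Real.log r := by have := Real.log_neg hr0 hr1; linarith
  have hpos : 0 < r ^ ℓ * -Real.log r := mul_pos (pow_pos hr0 _) hlog
  have hs : r ^ k = r ^ (k - ℓ) * r ^ ℓ := by rw [← pow_add, Nat.sub_add_cancel hℓk]
  rw [div_mul_eq_mul_div, div_le_iff₀ hk]
  refine le_of_mul_le_mul_right ?_ hpos
  calc _ = Real.binEntropy (r ^ k) * (r ^ ℓ * -(ℓ * Real.log r)) := by ring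
    _ ≤ _ := h
    _ = _ := by rw [hs]; ring

theorem mul_neg_log_le_one_sub_rpow {x s B : ℝ} (hx0 : 0 < x) (hx1 : x ≤ 1) (hs : 0 ≤ s)
    (hB : -Real.log x ≤ B) : s / (1 + s * B) * -Real.log x ≤ 1 - x ^ s := by
  set a := -Real.log x with ha
  have ha0 : 0 ≤ a := by have := Real.log_nonpos hx0.le hx1; linarith
  have hx : x ^ s = (Real.exp (s * a))⁻¹ := by
    rw [Real.rpow_def_of_pos hx0, ← Real.exp_neg]; congr 1; rw [ha]; ring
  have h1 : 0 ≤ s * a := mul_nonneg hs ha0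
  have h2 : s * a ≤ s * B := mul_le_mul_of_nonneg_left hB hs
  have h3 : (Real.exp (s * a))⁻¹ ≤ (1 + s * a)⁻¹ := by
    apply inv_anti₀ (by linarith)
    have := Real.add_one_le_exp (s * a)
    linarith
  rw [hx]
  calc s / (1 + s * B) * a = s * a / (1 + s * B) := by ring
    _ ≤ s * a / (1 + s * a) := div_le_div_of_nonneg_left h1 (by linarith) (by linarith)
    _ = 1 - (1 + s * a)⁻¹ := by field_simp; ring
    _ ≤ _ := by linarith

/-- For small tilts the gain is nearly the mutual information between the outcome of a test and the
`ℓ` unknown items, times the tilt. -/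
theorem mul_binEntropy_le_gain {q s B : ℝ} (hq0 : 0 < q) (hq1 : q < 1) {m ℓ : ℕ} (hℓ : 0 < ℓ)
    (hs : 0 ≤ s) (hB1 : -Real.log ((1 - q) ^ ℓ) ≤ B) (hB2 : -Real.log (1 - (1 - q) ^ ℓ) ≤ B) :
    s / (1 + s * B) * ((1 - q) ^ m * Real.binEntropy ((1 - q) ^ ℓ)) ≤ gain q m ℓ s := by
  have hu0 : 0 < (1 - q) ^ ℓ := pow_pos (by linarith) _
  have hu1 : (1 - q) ^ ℓ < 1 := pow_lt_one₀ (by linarith) (by linarith) hℓ.ne'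
  have h1 := mul_neg_log_le_one_sub_rpow hu0 hu1.le hs hB1
  have h2 := mul_neg_log_le_one_sub_rpow (x := 1 - (1 - q) ^ ℓ) (by linarith) (by linarith) hs hB2
  rw [gain, mul_left_comm]
  refine mul_le_mul_of_nonneg_left ?_ (pow_nonneg (by linarith) _)
  simp only [Real.binEntropy, Real.log_inv]
  have h3 := mul_le_mul_of_nonneg_left h1 hu0.le
  have h4 := mul_le_mul_of_nonneg_left h2 (by linarith : 0 ≤ 1 - (1 - q) ^ ℓ)
  linarith

/-- For few unknown items the gain is nearly the probability that one of the unknown items is the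
only defective item in a test. -/
theorem mul_le_gain {q s τ : ℝ} (hq0 : 0 < q) (hq1 : q < 1) {k ℓ : ℕ} (hℓk : ℓ ≤ k) (hs : 0 ≤ s)
    (hτ : (ℓ * q) ^ s ≤ τ) (hτ1 : τ ≤ 1) :
    ℓ * (q * (1 - q) ^ k) * (1 - τ) ≤ gain q (k - ℓ) ℓ s := by
  have hr : 0 < 1 - q := by linarith
  have hu0 : 0 < (1 - q) ^ ℓ := pow_pos hr _
  have hu1 : (1 - q) ^ ℓ ≤ 1 := pow_le_one₀ hr.le (by linarith)
  have hus : ((1 - q) ^ ℓ) ^ s ≤ 1 := Real.rpow_le_one hu0.le hu1 hs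
  have hbern : 1 - (1 - q) ^ ℓ ≤ ℓ * q := by
    have := one_add_mul_le_pow (a := -q) (by linarith) ℓ
    rw [← sub_eq_add_neg] at this
    linarith
  have hws : (1 - (1 - q) ^ ℓ) ^ s ≤ τ :=
    (Real.rpow_le_rpow (by linarith) hbern hs).trans hτ
  have hlow : (1 - q) ^ ℓ * (ℓ * q) ≤ 1 - (1 - q) ^ ℓ := by
    have h1 := one_add_mul_le_pow (a := q) (by linarith) ℓ
    have h2 : (1 - q) ^ ℓ * (1 + q) ^ ℓ ≤ 1 := by
      rw [← mul_pow]
      exact pow_le_one₀ (mul_nonneg hr.le (by linarith)) (by nlinarith)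
    have h3 := mul_le_mul_of_nonneg_left h1 hu0.le
    linarith
  have hsplit : (1 - q) ^ k = (1 - q) ^ (k - ℓ) * (1 - q) ^ ℓ := by
    rw [← pow_add, Nat.sub_add_cancel hℓk]
  rw [gain, hsplit]
  calc (ℓ : ℝ) * (q * ((1 - q) ^ (k - ℓ) * (1 - q) ^ ℓ)) * (1 - τ)
      = (1 - q) ^ (k - ℓ) * ((1 - q) ^ ℓ * (ℓ * q) * (1 - τ)) := by ring
    _ ≤ _ := by
      refine mul_le_mul_of_nonneg_left ?_ (pow_pos hr _).le
      have h1 := mul_le_mul hlow (by linarith : 1 - τ ≤ 1 - (1 - (1 - q) ^ ℓ) ^ s) (by linarith)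
        (by linarith)
      have h2 : 0 ≤ (1 - q) ^ ℓ * (1 - ((1 - q) ^ ℓ) ^ s) := mul_nonneg hu0.le (by linarith)
      linarith

theorem one_sub_gain_pow_le {q s : ℝ} (hq0 : 0 < q) (hq1 : q < 1) (m ℓ n : ℕ) :
    (1 - gain q m ℓ s) ^ n ≤ Real.exp (-(n * gain q m ℓ s)) := by
  have hr : 0 < 1 - q := by linarith
  have hu0 : 0 < (1 - q) ^ ℓ := pow_pos hr _
  have hu1 : (1 - q) ^ ℓ ≤ 1 := pow_le_one₀ hr.le (by linarith)
  have hv0 : 0 < (1 - q) ^ m := pow_pos hr _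
  have hv1 : (1 - q) ^ m ≤ 1 := pow_le_one₀ hr.le (by linarith)
  have hg : gain q m ℓ s ≤ 1 := by
    have h1 : 0 ≤ (1 - q) ^ ℓ * ((1 - q) ^ ℓ) ^ s := by positivity
    have h2 : 0 ≤ (1 - (1 - q) ^ ℓ) * (1 - (1 - q) ^ ℓ) ^ s :=
      mul_nonneg (by linarith) (Real.rpow_nonneg (by linarith) _)
    have h3 : (1 - q) ^ ℓ * (1 - ((1 - q) ^ ℓ) ^ s) +
        (1 - (1 - q) ^ ℓ) * (1 - (1 - (1 - q) ^ ℓ) ^ s) ≤ 1 := by linarith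
    exact (mul_le_mul_of_nonneg_left h3 hv0.le).trans (by linarith)
  calc (1 - gain q m ℓ s) ^ n ≤ Real.exp (-gain q m ℓ s) ^ n :=
        pow_le_pow_left₀ (by linarith) (Real.one_sub_le_exp_neg _) n
    _ = _ := by rw [← Real.exp_nat_mul]; congr 1; ring

theorem choose_le_exp_mul_log {m p : ℕ} (hmp : m ≤ p) (hp : 0 < p) (ℓ : ℕ) :
    (m.choose ℓ : ℝ) ≤ Real.exp (ℓ * Real.log p) := by
  have hp' : (0 : ℝ) < p := by exact_mod_cast hp
  rw [← Real.log_pow, Real.exp_log (by positivity)]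
  exact_mod_cast (Nat.choose_le_pow m ℓ).trans (Nat.pow_le_pow_left hmp ℓ)

theorem choose_le_exp_mul_log_div {m p ℓ : ℕ} (hmp : m ≤ p) (hp : 0 < p) (hℓ : 0 < ℓ) :
    (m.choose ℓ : ℝ) ≤ Real.exp (ℓ * (1 + Real.log (p / ℓ))) := by
  have hp' : (0 : ℝ) < p := by exact_mod_cast hp
  have hℓ' : (0 : ℝ) < ℓ := by exact_mod_cast hℓ
  have h1 : (m.choose ℓ : ℝ) ≤ (p : ℝ) ^ ℓ / (ℓ.factorial : ℝ) := by
    refine (Nat.choose_le_pow_div (α := ℝ) ℓ m).trans ?_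
    gcongr
  have h2 := Real.pow_div_factorial_le_exp (ℓ : ℝ) hℓ'.le ℓ
  have h3 : (p : ℝ) ^ ℓ / (ℓ.factorial : ℝ) =
      (p / ℓ : ℝ) ^ ℓ * ((ℓ : ℝ) ^ ℓ / (ℓ.factorial : ℝ)) := by
    rw [div_pow]; field_simp
  rw [mul_add, mul_one, Real.exp_add, ← Real.log_pow, Real.exp_log (by positivity), mul_comm]
  rw [h3] at h1
  exact h1.trans (mul_le_mul_of_nonneg_left h2 (by positivity))

theorem rpow_le_exp_mul {x y s : ℝ} (hx : 0 ≤ x) (hs : 0 ≤ s) (h : x ≤ Real.exp y) :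
    x ^ s ≤ Real.exp (s * y) := by
  rw [mul_comm, Real.exp_mul]
  exact Real.rpow_le_rpow hx h hs

/-! ### Terms of the union bound -/

/-- The contribution of few misidentified items to the union bound. -/
theorem few_misidentified_le {p k n ℓ : ℕ} {q s τ η θ : ℝ} (hk0 : 0 < k) (hkp : k ≤ p)
    (hq0 : 0 < q) (hq1 : q < 1) (hℓk : ℓ ≤ k) (hs0 : 0 ≤ s)
    (hs : s ≤ θ * η / 8) (hτ : (ℓ * q) ^ s ≤ τ) (hτ1 : τ ≤ 1)
    (hτη : 1 + 3 * η / 8 ≤ (1 - τ) * (1 + η / 2)) (hθ : 0 < θ)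
    (h1 : Real.log k ≤ θ * (1 + η / 8) * Real.log p)
    (h2 : θ * (1 + η / 2) * Real.log p ≤ n * (q * (1 - q) ^ k)) :
    (k.choose ℓ : ℝ) * (2 * ((p - k).choose ℓ : ℝ) ^ s * (1 - gain q (k - ℓ) ℓ s) ^ n) ≤
      2 * Real.exp (-(θ * η / 8 * Real.log p)) ^ ℓ := by
  have hp : 0 < p := hk0.trans_le hkp
  have hL : 0 ≤ Real.log p := Real.log_natCast_nonneg p
  have hg := mul_le_gain hq0 hq1 hℓk hs0 hτ hτ1
  have ha := choose_le_exp_mul_log le_rfl hk0 ℓ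
  have hb := rpow_le_exp_mul (by positivity) hs0
    (choose_le_exp_mul_log (Nat.sub_le p k) hp ℓ)
  have hc := one_sub_gain_pow_le (s := s) hq0 hq1 (k - ℓ) ℓ n
  have hn : (ℓ : ℝ) * ((1 + 3 * η / 8) * θ * Real.log p) ≤ n * gain q (k - ℓ) ℓ s := by
    calc (ℓ : ℝ) * ((1 + 3 * η / 8) * θ * Real.log p)
        ≤ ℓ * ((1 - τ) * (1 + η / 2) * θ * Real.log p) := by gcongr
      _ = ℓ * (1 - τ) * (θ * (1 + η / 2) * Real.log p) := by ring
      _ ≤ ℓ * (1 - τ) * (n * (q * (1 - q) ^ k)) :=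
          mul_le_mul_of_nonneg_left h2 (mul_nonneg (Nat.cast_nonneg _) (by linarith))
      _ = n * (ℓ * (q * (1 - q) ^ k) * (1 - τ)) := by ring
      _ ≤ _ := mul_le_mul_of_nonneg_left hg (Nat.cast_nonneg _)
  have hℓ1 := mul_le_mul_of_nonneg_left h1 (Nat.cast_nonneg (α := ℝ) ℓ)
  have hℓ2 := mul_le_mul_of_nonneg_left (mul_le_mul_of_nonneg_right hs hL)
    (Nat.cast_nonneg (α := ℝ) ℓ)
  calc _ ≤ Real.exp (ℓ * Real.log k) * (2 * Real.exp (s * (ℓ * Real.log p)) *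
        Real.exp (-(n * gain q (k - ℓ) ℓ s))) := by
        refine (mul_le_mul_of_nonneg_left (mul_le_mul_of_nonneg_left hc (by positivity))
          (by positivity)).trans ?_
        gcongr
    _ = 2 * Real.exp (ℓ * Real.log k + s * (ℓ * Real.log p) - n * gain q (k - ℓ) ℓ s) := by
        rw [Real.exp_sub, Real.exp_add, Real.exp_neg]; ring
    _ ≤ _ := by
        rw [← Real.exp_nat_mul]
        refine mul_le_mul_of_nonneg_left (Real.exp_le_exp.2 ?_) zero_le_two
        linarith

/-- The contribution of a constant fraction of misidentified items to the union bound. -/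
theorem many_misidentified_le {p k n ℓ : ℕ} {q s B δ η c : ℝ} (hk0 : 0 < k) (hkp : k ≤ p)
    (hq0 : 0 < q) (hq1 : q < 1) (hℓk : ℓ ≤ k) (hδ : 0 < δ) (hδℓ : δ * k ≤ ℓ) (hη : 0 < η)
    (hs0 : 0 < s) (hB0 : 0 ≤ B) (hsB : (1 + η / 4) * (1 + s * B) ≤ 1 + η / 2)
    (hB1 : -Real.log ((1 - q) ^ k) ≤ B) (hB2 : -Real.log (1 - Real.exp (-(δ * (k * q)))) ≤ B)
    (h1 : (1 + η / 2) * (k * Real.log (p / k)) ≤ n * Real.binEntropy ((1 - q) ^ k))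
    (h2 : 1 - Real.log δ ≤ η / 16 * Real.log (p / k))
    (h3 : Real.log 2 / δ ≤ s * (η / 16 * Real.log (p / k)))
    (h4 : c * Real.log p ≤ s * (η / 8 * Real.log (p / k))) :
    (k.choose ℓ : ℝ) * (2 * ((p - k).choose ℓ : ℝ) ^ s * (1 - gain q (k - ℓ) ℓ s) ^ n) ≤
      2 * Real.exp (-(c * Real.log p)) ^ ℓ := by
  have hp : 0 < p := hk0.trans_le hkp
  have hp' : (0 : ℝ) < p := by exact_mod_cast hp
  have hk' : (0 : ℝ) < k := by exact_mod_cast hk0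
  have hr : 0 < 1 - q := by linarith
  have hℓ' : (0 : ℝ) < ℓ := (mul_pos hδ hk').trans_le hδℓ
  have hℓ : 0 < ℓ := by exact_mod_cast hℓ'
  set Λ := Real.log ((p : ℝ) / k) with hΛ
  have hΛ0 : 0 ≤ Λ := Real.log_nonneg ((one_le_div hk').2 (by exact_mod_cast hkp))
  have hg : s / (1 + s * B) * ((1 - q) ^ (k - ℓ) * Real.binEntropy ((1 - q) ^ ℓ)) ≤
      gain q (k - ℓ) ℓ s := by
    refine mul_binEntropy_le_gain hq0 hq1 hℓ hs0.le (le_trans ?_ hB1) (le_trans ?_ hB2)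
    · exact neg_le_neg (Real.log_le_log (pow_pos hr _)
        (pow_le_pow_of_le_one hr.le (by linarith) hℓk))
    · refine neg_le_neg (Real.log_le_log ?_ ?_)
      · have : Real.exp (-(δ * (k * q))) < 1 := by
          rw [Real.exp_lt_one_iff]; have : 0 < δ * (k * q) := by positivity
          linarith
        linarith
      · have h5 : (1 - q) ^ ℓ ≤ Real.exp (-q) ^ ℓ :=
          pow_le_pow_left₀ hr.le (Real.one_sub_le_exp_neg q) ℓ
        have h6 : Real.exp (-q) ^ ℓ ≤ Real.exp (-(δ * (k * q))) := by
          rw [← Real.exp_nat_mul]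
          refine Real.exp_le_exp.2 ?_
          have := mul_le_mul_of_nonneg_right hδℓ hq0.le
          linarith
        linarith
  have hent := div_mul_binEntropy_pow_le hr (by linarith) hℓ hℓk
  have hsB0 : 0 < 1 + s * B := by positivity
  have hn : s * (ℓ * ((1 + η / 4) * Λ)) ≤ n * gain q (k - ℓ) ℓ s := by
    have h7 : (1 + η / 4) ≤ (1 + η / 2) / (1 + s * B) := (le_div_iff₀ hsB0).2 hsB
    calc s * (ℓ * ((1 + η / 4) * Λ)) ≤ s * (ℓ * ((1 + η / 2) / (1 + s * B) * Λ)) := by gcongr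
      _ = s / (1 + s * B) * (ℓ / k) * ((1 + η / 2) * (k * Λ)) := by field_simp
      _ ≤ s / (1 + s * B) * (ℓ / k) * (n * Real.binEntropy ((1 - q) ^ k)) := by gcongr
      _ = n * (s / (1 + s * B) * (ℓ / k * Real.binEntropy ((1 - q) ^ k))) := by ring
      _ ≤ n * (s / (1 + s * B) * ((1 - q) ^ (k - ℓ) * Real.binEntropy ((1 - q) ^ ℓ))) := by gcongr
      _ ≤ _ := by gcongr
  have ha : (k.choose ℓ : ℝ) ≤ Real.exp (k * Real.log 2) := by
    rw [← Real.log_pow, Real.exp_log (by positivity)]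
    exact_mod_cast Nat.choose_le_two_pow k ℓ
  have hb := rpow_le_exp_mul (by positivity) hs0.le
    (choose_le_exp_mul_log_div (Nat.sub_le p k) hp hℓ)
  have hc := one_sub_gain_pow_le (s := s) hq0 hq1 (k - ℓ) ℓ n
  have hlog : Real.log ((p : ℝ) / ℓ) ≤ Λ - Real.log δ := by
    rw [hΛ, ← Real.log_div (by positivity) hδ.ne']
    refine Real.log_le_log (by positivity) ?_
    rw [div_div]
    exact div_le_div_of_nonneg_left hp'.le (by positivity) (by linarith)
  have hkℓ : k * Real.log 2 ≤ s * (ℓ * (η / 16 * Λ)) := by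
    have h8 : (k : ℝ) ≤ ℓ / δ := by rw [le_div_iff₀ hδ]; linarith
    calc k * Real.log 2 ≤ ℓ / δ * Real.log 2 :=
          mul_le_mul_of_nonneg_right h8 (Real.log_nonneg one_le_two)
      _ = ℓ * (Real.log 2 / δ) := by ring
      _ ≤ ℓ * (s * (η / 16 * Λ)) := by gcongr
      _ = _ := by ring
  have hmid : s * (ℓ * (1 + Real.log ((p : ℝ) / ℓ))) ≤ s * (ℓ * (η / 16 * Λ + Λ)) := by
    refine mul_le_mul_of_nonneg_left (mul_le_mul_of_nonneg_left ?_ hℓ'.le) hs0.le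
    linarith
  have hend := mul_le_mul_of_nonneg_left h4 hℓ'.le
  calc _ ≤ Real.exp (k * Real.log 2) * (2 * Real.exp (s * (ℓ * (1 + Real.log ((p : ℝ) / ℓ)))) *
        Real.exp (-(n * gain q (k - ℓ) ℓ s))) := by
        refine (mul_le_mul_of_nonneg_left (mul_le_mul_of_nonneg_left hc (by positivity))
          (by positivity)).trans ?_
        gcongr
    _ = 2 * Real.exp (k * Real.log 2 + s * (ℓ * (1 + Real.log ((p : ℝ) / ℓ))) -
          n * gain q (k - ℓ) ℓ s) := by
        rw [Real.exp_sub, Real.exp_add, Real.exp_neg]; ring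
    _ ≤ _ := by
        rw [← Real.exp_nat_mul]
        refine mul_le_mul_of_nonneg_left (Real.exp_le_exp.2 ?_) zero_le_two
        linarith


/-! ### Asymptotics in the sparsity regime -/

theorem tendsto_log_natCast_atTop : Tendsto (fun p : ℕ => Real.log (p : ℝ)) atTop atTop :=
  Real.tendsto_log_atTop.comp tendsto_natCast_atTop_atTop

theorem SparsityRegime.tendsto_atTop {θ : ℝ} {k : ℕ → ℕ} (hk : SparsityRegime θ k) (hθ : 0 < θ) :
    Tendsto k atTop atTop := by
  rw [← tendsto_natCast_atTop_iff (R := ℝ)]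
  have h1 : Tendsto (fun p : ℕ => (p : ℝ) ^ θ) atTop atTop :=
    (tendsto_rpow_atTop hθ).comp tendsto_natCast_atTop_atTop
  have h2 := hk.tendsto_norm_atTop_iff.2 (tendsto_norm_atTop_atTop.comp h1)
  simpa [Function.comp_def] using h2

theorem SparsityRegime.tendsto_log_div_log {θ : ℝ} {k : ℕ → ℕ} (hk : SparsityRegime θ k)
    (hθ : 0 < θ) : Tendsto (fun p => Real.log (k p) / Real.log p) atTop (𝓝 θ) := by
  have hL := tendsto_log_natCast_atTop
  obtain ⟨C, hC, hup⟩ := hk.1.exists_pos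
  obtain ⟨c, hc, hlo⟩ := hk.2.exists_pos
  have hlim : ∀ a : ℝ, Tendsto (fun p : ℕ => Real.log a / Real.log (p : ℝ) + θ) atTop (𝓝 θ) := by
    intro a
    simpa using (hL.const_div_atTop (Real.log a)).add_const θ
  refine tendsto_of_tendsto_of_tendsto_of_le_of_le' (hlim c⁻¹) (hlim C) ?_ ?_
  · filter_upwards [hlo.bound, hL.eventually_gt_atTop 0, eventually_gt_atTop 0,
      (hk.tendsto_atTop hθ).eventually_gt_atTop 0] with p h h0 hp hkp
    have hp' : (0 : ℝ) < p := by exact_mod_cast hp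
    have hkp' : (0 : ℝ) < k p := by exact_mod_cast hkp
    rw [Real.norm_of_nonneg (Real.rpow_nonneg hp'.le _), Real.norm_of_nonneg hkp'.le] at h
    have h1 := Real.log_le_log (Real.rpow_pos_of_pos hp' _) h
    rw [Real.log_rpow hp', Real.log_mul hc.ne' hkp'.ne'] at h1
    rw [Real.log_inv, div_add' _ _ _ h0.ne']
    refine div_le_div_of_nonneg_right ?_ h0.le
    linarith
  · filter_upwards [hup.bound, hL.eventually_gt_atTop 0, eventually_gt_atTop 0,
      (hk.tendsto_atTop hθ).eventually_gt_atTop 0] with p h h0 hp hkp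
    have hp' : (0 : ℝ) < p := by exact_mod_cast hp
    have hkp' : (0 : ℝ) < k p := by exact_mod_cast hkp
    rw [Real.norm_of_nonneg (Real.rpow_nonneg hp'.le _), Real.norm_of_nonneg hkp'.le] at h
    have h1 := Real.log_le_log hkp' h
    rw [Real.log_mul hC.ne' (Real.rpow_pos_of_pos hp' _).ne', Real.log_rpow hp'] at h1
    rw [div_add' _ _ _ h0.ne']
    refine div_le_div_of_nonneg_right ?_ h0.le
    linarith

theorem SparsityRegime.eventually_le {θ : ℝ} {k : ℕ → ℕ} (hk : SparsityRegime θ k) (hθ : 0 < θ)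
    (hθ1 : θ < 1) : ∀ᶠ p in atTop, k p ≤ p := by
  have hL := tendsto_log_natCast_atTop
  filter_upwards [(hk.tendsto_log_div_log hθ).eventually_lt_const hθ1, hL.eventually_gt_atTop 0,
    eventually_gt_atTop 0, (hk.tendsto_atTop hθ).eventually_gt_atTop 0] with p h h0 hp hkp
  rw [div_lt_one h0] at h
  have h1 := (Real.log_lt_log_iff (by exact_mod_cast hkp) (by exact_mod_cast hp)).1 h
  exact_mod_cast h1.le

theorem SparsityRegime.tendsto_log_div_div_log {θ : ℝ} {k : ℕ → ℕ} (hk : SparsityRegime θ k)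
    (hθ : 0 < θ) :
    Tendsto (fun p : ℕ => Real.log ((p : ℝ) / k p) / Real.log p) atTop (𝓝 (1 - θ)) := by
  have hL := tendsto_log_natCast_atTop
  refine ((hk.tendsto_log_div_log hθ).const_sub 1).congr' ?_
  filter_upwards [hL.eventually_gt_atTop 0, eventually_gt_atTop 0,
    (hk.tendsto_atTop hθ).eventually_gt_atTop 0] with p h0 hp hkp
  rw [Real.log_div (by exact_mod_cast hp.ne') (by exact_mod_cast hkp.ne'), sub_div,
    div_self h0.ne']

theorem SparsityRegime.tendsto_log_div {θ : ℝ} {k : ℕ → ℕ} (hk : SparsityRegime θ k)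
    (hθ : 0 < θ) (hθ1 : θ < 1) :
    Tendsto (fun p : ℕ => Real.log ((p : ℝ) / k p)) atTop atTop := by
  have hL := tendsto_log_natCast_atTop
  refine ((hk.tendsto_log_div_div_log hθ).pos_mul_atTop (by linarith) hL).congr' ?_
  filter_upwards [hL.eventually_gt_atTop 0] with p h0
  rw [div_mul_cancel₀ _ h0.ne']

theorem coe_inclusionProb {ν : ℝ} {k : ℕ} (hν : 0 ≤ ν) (hk : 0 < k) (hνk : ν ≤ k) :
    (inclusionProb ν k : ℝ) = ν / k := by
  have hk' : (0 : ℝ) < k := by exact_mod_cast hk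
  rw [inclusionProb, Set.coe_projIcc, min_eq_right ((div_le_one hk').2 hνk),
    max_eq_right (by positivity)]

/-! ### Achievability above the coefficient -/

theorem sum_Icc_pow_le {x : ℝ} (hx0 : 0 ≤ x) (hx : x ≤ 1 / 2) (k : ℕ) :
    ∑ ℓ ∈ Finset.Icc 1 k, x ^ ℓ ≤ 2 * x := by
  have h : ∑ ℓ ∈ Finset.Icc 1 k, x ^ ℓ = x * ∑ i ∈ Finset.range k, x ^ i := by
    rw [Finset.mul_sum, Finset.range_eq_Ico, ← Finset.Ico_add_one_right_eq_Icc,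
      Finset.sum_Ico_eq_sum_range, Finset.range_eq_Ico]
    simp [pow_add]
  have h1 : ∑ i ∈ Finset.range k, x ^ i ≤ 2 := by
    have h2 := mul_neg_geom_sum x k
    have h3 := Finset.sum_nonneg fun i (_ : i ∈ Finset.range k) => pow_nonneg hx0 i
    have h4 := pow_nonneg hx0 k
    nlinarith
  rw [h, mul_comm]
  exact mul_le_mul_of_nonneg_right h1 hx0

theorem binEntropy_exp_neg_pos {ν : ℝ} (hν : 0 < ν) : 0 < Real.binEntropy (Real.exp (-ν)) :=
  Real.binEntropy_pos (Real.exp_pos _) (by rw [Real.exp_lt_one_iff]; linarith)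

/-- For every fixed design parameter `ν`, optimized or not, `coeff θ ν * (k log (p / k)) * (1 + η)` tests
suffice. -/
theorem tendsto_errorProb_consistentDecoder {θ ν η : ℝ} (hθ0 : 0 < θ) (hθ1 : θ < 1) (hν : 0 < ν)
    (hη : 0 < η) {k n : ℕ → ℕ} (hk : SparsityRegime θ k)
    (hn : ∀ᶠ p : ℕ in atTop,
      coeff θ ν * ((k p : ℝ) * Real.log ((p : ℝ) / (k p : ℝ))) * (1 + η) ≤ (n p : ℝ)) :
    Tendsto (fun p => errorProb (n p) p (k p) ν (consistentDecoder (n p) p (k p))) atTop (𝓝 0) := by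
  have hL := tendsto_log_natCast_atTop
  have hkinf := hk.tendsto_atTop hθ0
  have hkreal : Tendsto (fun p => (k p : ℝ)) atTop atTop :=
    tendsto_natCast_atTop_atTop.comp hkinf
  have hΛ := hk.tendsto_log_div hθ0 hθ1
  have hent := binEntropy_exp_neg_pos hν
  -- Sets with at most `δ k` misidentified items. The count of candidates costs `s₁ log p` per item,
  -- a fraction of `η log k`; then `δ` is taken so small that `1 - (δ ν) ^ s₁` is nearly `1`.
  obtain ⟨s₁, hs₁0, hs₁1, hs₁⟩ : ∃ s : ℝ, 0 < s ∧ s ≤ 1 ∧ s ≤ θ * η / 8 :=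
    ⟨min 1 (θ * η / 8), by positivity, min_le_left _ _, min_le_right _ _⟩
  obtain ⟨τ, hτ0, hτ1, hτ⟩ : ∃ τ : ℝ, 0 < τ ∧ τ ≤ 1 ∧ 1 + 3 * η / 8 ≤ (1 - τ) * (1 + η / 2) := by
    refine ⟨η / 8 / (1 + η / 2), by positivity, ?_, le_of_eq ?_⟩
    · rw [div_le_one (by positivity)]; linarith
    · field_simp; ring
  obtain ⟨δ, hδ0, hδ⟩ : ∃ δ : ℝ, 0 < δ ∧ (δ * ν) ^ s₁ = τ := by
    refine ⟨τ ^ s₁⁻¹ / ν, by positivity, ?_⟩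
    rw [div_mul_cancel₀ _ hν.ne', Real.rpow_inv_rpow hτ0.le hs₁0.ne']
  -- Sets with more misidentified items. Here `B` bounds the relevant self-informations, which is
  -- possible only for fixed `δ`, so that the second tilt `s₂` has to be chosen after `δ`.
  set B : ℝ := max (ν + 1) (-Real.log (1 - Real.exp (-(δ * ν)))) with hB
  have hB0 : 0 < B := lt_max_of_lt_left (by linarith)
  obtain ⟨s₂, hs₂0, hs₂1, hs₂⟩ :
      ∃ s : ℝ, 0 < s ∧ s ≤ 1 ∧ (1 + η / 4) * (1 + s * B) ≤ 1 + η / 2 := by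
    refine ⟨min 1 (η / 4 / ((1 + η / 4) * B)), by positivity, min_le_left _ _, ?_⟩
    have h : min 1 (η / 4 / ((1 + η / 4) * B)) * ((1 + η / 4) * B) ≤ η / 4 :=
      (le_div_iff₀ (by positivity)).1 (min_le_right _ _)
    linarith
  set c : ℝ := min (θ * η / 8) (s₂ * (η / 8 * ((1 - θ) / 2))) with hc
  have hc0 : 0 < c := by
    have : 0 < 1 - θ := by linarith
    positivity
  have hP : Tendsto (fun p => (1 - ν / (k p : ℝ)) ^ k p) atTop (𝓝 (Real.exp (-ν))) := by
    have := (Real.tendsto_one_add_div_pow_exp (-ν)).comp hkinf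
    simpa [Function.comp_def, neg_div, ← sub_eq_add_neg] using this
  -- `e2` rests on the first term of the coefficient, `e3` on the second.
  have e1 : ∀ᶠ p : ℕ in atTop, Real.log (k p) ≤ θ * (1 + η / 8) * Real.log p := by
    have h : θ < θ * (1 + η / 8) := by nlinarith [mul_pos hθ0 hη]
    filter_upwards [(hk.tendsto_log_div_log hθ0).eventually_lt_const h,
      hL.eventually_gt_atTop 0] with p h1 h2
    exact ((div_lt_iff₀ h2).1 h1).le
  have e2 : ∀ᶠ p : ℕ in atTop, θ * (1 + η / 2) * Real.log p ≤
      n p * (ν / (k p : ℝ) * (1 - ν / (k p : ℝ)) ^ k p) := by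
    have hg := ((hk.tendsto_log_div_div_log hθ0).mul (hP.div_const (Real.exp (-ν)))).mul_const
      ((1 + η) / (1 - θ))
    have hlim : 1 + η / 2 <
        (1 - θ) * (Real.exp (-ν) / Real.exp (-ν)) * ((1 + η) / (1 - θ)) := by
      rw [div_self (Real.exp_pos _).ne', mul_one, mul_div_cancel₀ _ (by linarith : 1 - θ ≠ 0)]
      linarith
    filter_upwards [hg.eventually_const_lt hlim, hn, hL.eventually_gt_atTop 0,
      hΛ.eventually_gt_atTop 0, hkreal.eventually_gt_atTop 0,
      hP.eventually_const_lt (Real.exp_pos _)] with p h1 h2 h3 h4 h5 h6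
    have h7 : 0 < 1 - θ := by linarith
    have h8 : θ / (Real.exp (-ν) * ν * (1 - θ)) ≤ coeff θ ν := le_max_left _ _
    set P := (1 - ν / (k p : ℝ)) ^ k p
    calc θ * (1 + η / 2) * Real.log p
        ≤ θ * (Real.log ((p : ℝ) / k p) / Real.log p * (P / Real.exp (-ν)) *
            ((1 + η) / (1 - θ))) * Real.log p := by gcongr
      _ = θ / (Real.exp (-ν) * ν * (1 - θ)) * (k p * Real.log ((p : ℝ) / k p)) * (1 + η) *
            (ν / (k p : ℝ) * P) := by
          have := Real.exp_pos (-ν)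
          field_simp
      _ ≤ coeff θ ν * (k p * Real.log ((p : ℝ) / k p)) * (1 + η) * (ν / (k p : ℝ) * P) := by gcongr
      _ ≤ _ := by gcongr
  have e3 : ∀ᶠ p : ℕ in atTop, (1 + η / 2) * (k p * Real.log ((p : ℝ) / k p)) ≤
      n p * Real.binEntropy ((1 - ν / (k p : ℝ)) ^ k p) := by
    have hg := ((Real.binEntropy_continuous.tendsto _).comp hP).const_mul
      ((1 + η) / Real.binEntropy (Real.exp (-ν)))
    have hlim : 1 + η / 2 <
        (1 + η) / Real.binEntropy (Real.exp (-ν)) * Real.binEntropy (Real.exp (-ν)) := by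
      rw [div_mul_cancel₀ _ hent.ne']; linarith
    filter_upwards [hg.eventually_const_lt hlim, hn, hΛ.eventually_gt_atTop 0,
      hkreal.eventually_gt_atTop 0,
      ((Real.binEntropy_continuous.tendsto _).comp hP).eventually_const_lt hent]
      with p h1 h2 h3 h4 h5
    simp only [Function.comp_apply] at h1 h5
    have h8 : 1 / Real.binEntropy (Real.exp (-ν)) ≤ coeff θ ν := le_max_right _ _
    set H := Real.binEntropy ((1 - ν / (k p : ℝ)) ^ k p)
    calc (1 + η / 2) * (k p * Real.log ((p : ℝ) / k p))
        ≤ (1 + η) / Real.binEntropy (Real.exp (-ν)) * H * (k p * Real.log ((p : ℝ) / k p)) := by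
          gcongr
      _ = 1 / Real.binEntropy (Real.exp (-ν)) * (k p * Real.log ((p : ℝ) / k p)) * (1 + η) * H := by
          ring
      _ ≤ coeff θ ν * (k p * Real.log ((p : ℝ) / k p)) * (1 + η) * H := by gcongr
      _ ≤ _ := by gcongr
  have e4 : ∀ᶠ p : ℕ in atTop, (1 - θ) / 2 * Real.log p ≤ Real.log ((p : ℝ) / k p) := by
    have h : (1 - θ) / 2 < 1 - θ := by linarith
    filter_upwards [(hk.tendsto_log_div_div_log hθ0).eventually_const_lt h,
      hL.eventually_gt_atTop 0] with p h1 h2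
    exact ((lt_div_iff₀ h2).1 h1).le
  have e5 : ∀ᶠ p : ℕ in atTop, Real.exp (-(ν + 1)) < (1 - ν / (k p : ℝ)) ^ k p :=
    hP.eventually_const_lt (Real.exp_lt_exp.2 (by linarith))
  have e6 := (hΛ.const_mul_atTop (by positivity : 0 < η / 16)).eventually_ge_atTop (1 - Real.log δ)
  have e7 := ((hΛ.const_mul_atTop (by positivity : 0 < η / 16)).const_mul_atTop
    hs₂0).eventually_ge_atTop (Real.log 2 / δ)
  have hx : Tendsto (fun p : ℕ => Real.exp (-(c * Real.log p))) atTop (𝓝 0) :=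
    Real.tendsto_exp_neg_atTop_nhds_zero.comp (hL.const_mul_atTop hc0)
  have hx4 : Tendsto (fun p : ℕ => 2 * (2 * Real.exp (-(c * Real.log p)))) atTop (𝓝 0) := by
    simpa using (hx.const_mul 2).const_mul 2
  refine tendsto_of_tendsto_of_tendsto_of_le_of_le' tendsto_const_nhds hx4
    (Eventually.of_forall fun p => measureReal_nonneg) ?_
  filter_upwards [e1, e2, e3, e4, e5, e6, e7, hx.eventually_le_const (by norm_num : (0 : ℝ) < 1 / 2),
    hk.eventually_le hθ0 hθ1, hkreal.eventually_gt_atTop ν, hkinf.eventually_gt_atTop 0,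
    hL.eventually_ge_atTop 0, hΛ.eventually_ge_atTop 0]
    with p h1 h2 h3 h4 h5 h6 h7 h8 hkp hkν hk0 hL0 hΛ0
  have hk' : (0 : ℝ) < k p := by exact_mod_cast hk0
  have hq := coe_inclusionProb hν.le hk0 hkν.le
  have hq0 : 0 < (inclusionProb ν (k p) : ℝ) := by rw [hq]; positivity
  have hq1 : (inclusionProb ν (k p) : ℝ) < 1 := by rw [hq]; exact (div_lt_one hk').2 hkν
  rw [← hq] at h2 h3 h5
  have hkq : k p * (inclusionProb ν (k p) : ℝ) = ν := by rw [hq]; field_simp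
  refine (errorProb_consistentDecoder_le hkp hq0 hq1
    (s := fun ℓ => if (ℓ : ℝ) ≤ δ * k p then s₁ else s₂) (fun ℓ => ?_) fun ℓ => ?_).trans ?_
  · split_ifs <;> linarith
  · split_ifs <;> linarith
  calc _ ≤ ∑ ℓ ∈ Finset.Icc 1 (k p), 2 * Real.exp (-(c * Real.log p)) ^ ℓ := by
        refine Finset.sum_le_sum fun ℓ hℓ => ?_
        have hℓk := (Finset.mem_Icc.1 hℓ).2
        split_ifs with hcase
        · have hτℓ : (ℓ * (inclusionProb ν (k p) : ℝ)) ^ s₁ ≤ τ := by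
            rw [← hδ]
            refine Real.rpow_le_rpow (by positivity) ?_ hs₁0.le
            have := mul_le_mul_of_nonneg_right hcase hq0.le
            rwa [mul_assoc, hkq] at this
          refine (few_misidentified_le hk0 hkp hq0 hq1 hℓk hs₁0.le hs₁ hτℓ hτ1 hτ hθ0 h1 h2).trans ?_
          gcongr
          exact min_le_left _ _
        · refine many_misidentified_le hk0 hkp hq0 hq1 hℓk hδ0 (not_le.1 hcase).le hη hs₂0 hB0.le
            hs₂ ?_ ?_ h3 h6 h7 ?_
          · refine le_trans ?_ (le_max_left _ _)
            have := Real.log_lt_log (Real.exp_pos _) h5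
            rw [Real.log_exp] at this
            linarith
          · rw [hkq]; exact le_max_right _ _
          · calc c * Real.log p ≤ s₂ * (η / 8 * ((1 - θ) / 2)) * Real.log p := by
                  gcongr; exact min_le_right _ _
              _ = s₂ * (η / 8 * ((1 - θ) / 2 * Real.log p)) := by ring
              _ ≤ _ := by gcongr
    _ ≤ _ := by
        rw [← Finset.mul_sum]
        exact mul_le_mul_of_nonneg_left (sum_Icc_pow_le (Real.exp_pos _).le h8 _) zero_le_two

/-! ### The strong converse -/

theorem pow_le_choose_of_le {k p : ℕ} (hk : 0 < k) (hkp : k ≤ p) :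
    ((p : ℝ) / k) ^ k ≤ p.choose k := by
  induction k, hk using Nat.le_induction generalizing p with
  | base => simp
  | succ k hk ih =>
    obtain ⟨p, rfl⟩ : ∃ m, p = m + 1 := ⟨p - 1, by omega⟩
    have hkp' : k ≤ p := by omega
    have hk' : (0 : ℝ) < k := by exact_mod_cast hk
    have h1 : ((p : ℝ) + 1) / (k + 1) ≤ p / k := by
      rw [div_le_div_iff₀ (by positivity) hk']
      have : (k : ℝ) ≤ p := by exact_mod_cast hkp'
      linarith
    have h2 : ((p + 1).choose (k + 1) : ℝ) = ((p : ℝ) + 1) / (k + 1) * p.choose k := by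
      have := Nat.add_one_mul_choose_eq p k
      field_simp
      exact_mod_cast this.symm
    rw [h2, pow_succ']
    push_cast
    gcongr
    exact (pow_le_pow_left₀ (by positivity) h1 k).trans (ih hkp')

/-- The strong converse, by counting: `2 ^ n` outcomes cannot distinguish `p.choose k` sets. -/
theorem tendsto_errorProb_one {θ ν η : ℝ} (hθ0 : 0 < θ) (hθ1 : θ < 1) (hη : 0 < η)
    {k n : ℕ → ℕ} (hk : SparsityRegime θ k)
    (hn : ∀ᶠ p : ℕ in atTop,
      (n p : ℝ) ≤ ((k p : ℝ) * Real.log ((p : ℝ) / (k p : ℝ))) / Real.log 2 * (1 - η))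
    (dec : (p : ℕ) → Decoder (n p) p) :
    Tendsto (fun p => errorProb (n p) p (k p) ν (dec p)) atTop (𝓝 1) := by
  have hkinf := hk.tendsto_atTop hθ0
  have hkreal : Tendsto (fun p => (k p : ℝ)) atTop atTop :=
    tendsto_natCast_atTop_atTop.comp hkinf
  have hinf := (hkreal.atTop_mul_atTop₀ (hk.tendsto_log_div hθ0 hθ1)).const_mul_atTop hη
  have hlow := (Real.tendsto_exp_neg_atTop_nhds_zero.comp hinf).const_sub 1
  rw [sub_zero] at hlow
  refine tendsto_of_tendsto_of_tendsto_of_le_of_le' hlow tendsto_const_nhds ?_ ?_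
  · filter_upwards [hn, hk.eventually_le hθ0 hθ1, hkinf.eventually_gt_atTop 0] with p h1 hkp hk0
    have hlog2 : 0 < Real.log 2 := Real.log_pos one_lt_two
    have hk' : (0 : ℝ) < k p := by exact_mod_cast hk0
    have hp' : (0 : ℝ) < p := by exact_mod_cast hk0.trans_le hkp
    have h2 := one_sub_errorProb_le (n := n p) (ν := ν) hkp (dec p)
    have h3 : (2 : ℝ) ^ n p / (p.choose (k p)) ≤
        Real.exp (-(η * (k p * Real.log ((p : ℝ) / k p)))) := by
      have h4 : Real.exp (k p * Real.log ((p : ℝ) / k p)) ≤ p.choose (k p) := by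
        rw [← Real.log_pow, Real.exp_log (by positivity)]
        exact pow_le_choose_of_le hk0 hkp
      rw [div_mul_eq_mul_div, le_div_iff₀ hlog2] at h1
      have h5 : (2 : ℝ) ^ n p = Real.exp (n p * Real.log 2) := by
        rw [← Real.log_pow, Real.exp_log (by positivity)]
      rw [div_le_iff₀ ((Real.exp_pos _).trans_le h4), h5]
      refine le_trans ?_ (mul_le_mul_of_nonneg_left h4 (Real.exp_pos _).le)
      rw [← Real.exp_add, Real.exp_le_exp]
      linarith
    simp only [Function.comp_apply]
    linarith
  · filter_upwards [hk.eventually_le hθ0 hθ1] with p hkp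
    have := isProbabilityMeasure_defectiveLaw hkp
    have hprob : IsProbabilityMeasure (modelLaw (n p) p (k p) ν) := by
      unfold modelLaw; infer_instance
    exact measureReal_le_one

/-! ### Optimization of the design parameter -/

theorem isOptimalParam_of_forall_le {θ ν : ℝ} (hν : 0 < ν) (h : ∀ μ, 0 < μ → coeff θ ν ≤ coeff θ μ) :
    IsOptimalParam θ ν := by
  have : Nonempty (Set.Ioi (0 : ℝ)) := ⟨⟨ν, hν⟩⟩
  refine ⟨hν, le_antisymm (le_ciInf fun μ => h μ μ.2) ?_⟩
  exact ciInf_le (f := fun μ : Set.Ioi (0 : ℝ) => coeff θ μ)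
    ⟨coeff θ ν, by rintro _ ⟨μ, rfl⟩; exact h μ μ.2⟩ ⟨ν, hν⟩

/-- The infimum is attained: the coefficient is continuous on `(0, ∞)`, and its first term tends to
infinity at both ends. -/
theorem exists_isOptimalParam {θ : ℝ} (hθ0 : 0 < θ) (hθ1 : θ < 1) : ∃ ν, IsOptimalParam θ ν := by
  have h1θ : 0 < 1 - θ := by linarith
  set C : ℝ := θ / (1 - θ) with hC
  have hC0 : 0 < C := by positivity
  have hlow : ∀ ν, 0 < ν → C / ν ≤ coeff θ ν ∧ C * ν / 2 ≤ coeff θ ν := by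
    intro ν hν
    have h : C * Real.exp ν / ν ≤ coeff θ ν := by
      refine le_trans (le_of_eq ?_) (le_max_left _ _)
      rw [hC, Real.exp_neg]
      field_simp
    have hexp := Real.quadratic_le_exp_of_nonneg hν.le
    constructor
    · refine le_trans ?_ h
      gcongr
      nlinarith
    · refine le_trans ?_ h
      rw [div_le_div_iff₀ two_pos hν]
      nlinarith
  have hK0 : 0 < coeff θ 1 := by have := (hlow 1 one_pos).1; linarith [div_one C]
  set K := coeff θ 1 with hK
  set a := min 1 (C / K) with ha
  set b := max 1 (2 * K / C) with hb
  have ha0 : 0 < a := by positivity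
  have hcont : ContinuousOn (coeff θ) (Set.Icc a b) := by
    have hpos : ∀ ν ∈ Set.Icc a b, 0 < ν := fun ν hν => ha0.trans_le hν.1
    unfold coeff
    refine ContinuousOn.sup (ContinuousOn.div (by fun_prop) (by fun_prop) fun ν hν => ?_)
      (ContinuousOn.div (by fun_prop) (by fun_prop) fun ν hν => ?_)
    · have := hpos ν hν
      positivity
    · exact (binEntropy_exp_neg_pos (hpos ν hν)).ne'
  have h1mem : (1 : ℝ) ∈ Set.Icc a b := ⟨min_le_left _ _, le_max_left _ _⟩
  obtain ⟨ν, hν, hmin⟩ := isCompact_Icc.exists_isMinOn ⟨1, h1mem⟩ hcont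
  refine ⟨ν, isOptimalParam_of_forall_le (ha0.trans_le hν.1) fun μ hμ => ?_⟩
  have hνK : coeff θ ν ≤ K := hmin h1mem
  rcases lt_or_ge μ a with h | h
  · refine hνK.trans (le_trans ?_ (hlow μ hμ).1)
    rw [le_div_iff₀ hμ]
    have := (le_div_iff₀ hK0).1 (h.le.trans (min_le_right _ _))
    linarith
  rcases lt_or_ge b μ with h' | h'
  · refine hνK.trans (le_trans ?_ (hlow μ hμ).2)
    have := (div_le_iff₀ hC0).1 ((le_max_right _ _).trans h'.le)
    linarith
  · exact hmin ⟨h, h'⟩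

theorem coeff_log_two {θ : ℝ} (hθ1 : θ < 1) (hθ : θ ≤ 1 / 3) :
    coeff θ (Real.log 2) = 1 / Real.log 2 := by
  have hlog2 : 0 < Real.log 2 := Real.log_pos one_lt_two
  have he : Real.exp (-Real.log 2) = 2⁻¹ := by rw [Real.exp_neg, Real.exp_log two_pos]
  rw [coeff, he, Real.binEntropy_two_inv, max_eq_right]
  have h1θ : 0 < 1 - θ := by linarith
  rw [div_le_div_iff₀ (by positivity) hlog2]
  nlinarith

theorem isOptimalParam_log_two {θ : ℝ} (hθ1 : θ < 1) (hθ : θ ≤ 1 / 3) :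
    IsOptimalParam θ (Real.log 2) := by
  refine isOptimalParam_of_forall_le (Real.log_pos one_lt_two) fun μ hμ => ?_
  rw [coeff_log_two hθ1 hθ]
  exact (one_div_le_one_div_of_le (binEntropy_exp_neg_pos hμ) Real.binEntropy_le_log_two).trans
    (le_max_right _ _)

end

end GroupTesting

theorem corollary6 (θ : ℝ) (hθ0 : 0 < θ) (hθ1 : θ < 1) :
    -- achievability with an optimized parameter
    ((∃ ν : ℝ, GroupTesting.IsOptimalParam θ ν) ∧
      ∀ ν : ℝ, GroupTesting.IsOptimalParam θ ν →
      ∀ k n : ℕ → ℕ, GroupTesting.SparsityRegime θ k →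
      ∀ η : ℝ, 0 < η →
      (∀ᶠ p : ℕ in atTop,
        GroupTesting.optCoeff θ * ((k p : ℝ) * Real.log ((p : ℝ) / (k p : ℝ))) * (1 + η)
          ≤ (n p : ℝ)) →
      ∃ dec : (p : ℕ) → GroupTesting.Decoder (n p) p,
        Tendsto (fun p : ℕ => GroupTesting.errorProb (n p) p (k p) ν (dec p)) atTop (𝓝 0)) ∧
    -- strong converse, for every parameter and every decoder
    (∀ ν : ℝ, 0 < ν →
      ∀ k n : ℕ → ℕ, GroupTesting.SparsityRegime θ k →
      ∀ η : ℝ, 0 < η →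
      (∀ᶠ p : ℕ in atTop,
        (n p : ℝ) ≤
          ((k p : ℝ) * Real.log ((p : ℝ) / (k p : ℝ))) / Real.log 2 * (1 - η)) →
      ∀ dec : (p : ℕ) → GroupTesting.Decoder (n p) p,
        Tendsto (fun p : ℕ => GroupTesting.errorProb (n p) p (k p) ν (dec p)) atTop (𝓝 1)) ∧
    -- the exact threshold for small exponents
    (θ ≤ 1 / 3 →
      GroupTesting.optCoeff θ = 1 / Real.log 2 ∧
      GroupTesting.IsOptimalParam θ (Real.log 2) ∧
      ∀ k n : ℕ → ℕ, GroupTesting.SparsityRegime θ k →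
      ∀ η : ℝ, 0 < η →
      ((∀ᶠ p : ℕ in atTop,
          (k p : ℝ) * Real.logb 2 ((p : ℝ) / (k p : ℝ)) * (1 + η) ≤ (n p : ℝ)) →
        ∃ dec : (p : ℕ) → GroupTesting.Decoder (n p) p,
          Tendsto (fun p : ℕ => GroupTesting.errorProb (n p) p (k p) (Real.log 2) (dec p))
            atTop (𝓝 0)) ∧
      ((∀ᶠ p : ℕ in atTop,
          (n p : ℝ) ≤ (k p : ℝ) * Real.logb 2 ((p : ℝ) / (k p : ℝ)) * (1 - η)) →
        ∀ ν : ℝ, 0 < ν → ∀ dec : (p : ℕ) → GroupTesting.Decoder (n p) p,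
          Tendsto (fun p : ℕ => GroupTesting.errorProb (n p) p (k p) ν (dec p))
            atTop (𝓝 1))) := by
  refine ⟨⟨GroupTesting.exists_isOptimalParam hθ0 hθ1, ?_⟩, ?_, ?_⟩
  · rintro ν ⟨hν, hopt⟩ k n hk η hη hn
    rw [← hopt] at hn
    exact ⟨_, GroupTesting.tendsto_errorProb_consistentDecoder hθ0 hθ1 hν hη hk hn⟩
  · intro ν _ k n hk η hη hn dec
    exact GroupTesting.tendsto_errorProb_one hθ0 hθ1 hη hk hn dec
  · intro hθ
    have hcoeff := GroupTesting.coeff_log_two hθ1 hθ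
    have hopt := GroupTesting.isOptimalParam_log_two hθ1 hθ
    refine ⟨hopt.2.symm.trans hcoeff, hopt, fun k n hk η hη => ⟨fun hn => ?_, fun hn => ?_⟩⟩
    · refine ⟨_, GroupTesting.tendsto_errorProb_consistentDecoder hθ0 hθ1 hopt.1 hη hk ?_⟩
      filter_upwards [hn] with p h
      refine le_trans (le_of_eq ?_) h
      rw [hcoeff, Real.logb]
      ring
    · intro ν _ dec
      refine GroupTesting.tendsto_errorProb_one hθ0 hθ1 hη hk ?_ dec
      filter_upwards [hn] with p h
      refine h.trans (le_of_eq ?_)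
      rw [Real.logb]
      ring
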